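/- Let $n\ge 1$ and $d,g,k\ge 0$ be integers, let $t_1,\dots,t_n\in\mathbb{R}^d$ be tuples and let $\pi$ be a ranking of them, $\pi(a)$ being the tuple in position $a$. A *solution* of the $g$-Group Bonus Linear Ranking instance $(t,\pi,k)$ consists of weights $w\in\mathbb{R}^d$, bonuses $v_1,\dots,v_g\ge 0$ and disjoint sets of tuples $G_1,\dots,G_g$ with $\sum_i|G_i|\le k$ such that $\pi$ lists the tuples in strictly decreasing order of the score $f(t_p)=\langle w,t_p\rangle+\sum_{i:\,t_p\in G_i}v_i$. The algorithm MGRA works as follows. 1. *Lifting.* Each tuple $t_p$ is replaced by $g+1$ copies in $\mathbb{R}^{d+g}$: $t_p^{(0)}=(t_p,0)$ and $t_p^{(i)}=(t_p,e_i)$ for $1\le i\le g$. 2. *Arrangement.* For each pair of copies with different vectors $x\ne y$, form the hyperplane $\{u\in\mathbb{R}^{d+g}:\langle u,x\rangle=\langle u,y\rangle\}$. A cell is a nonempty set of all the vectors $u$ that lie on none of the hyperplanes and have the same location vector, i.e. agree on which copy of each pair scores higher. Enumerate, in any order, the cells on which the last $g$ coordinates are positive, and take any one vector $u$ from each. 3.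 *Ranking.* For each such $u$, let $\rho$ be the list of all the copies in decreasing order of $\langle u,\cdot\rangle$. (Copies with equal vectors, which exist only if two tuples coincide, are listed in the order opposite to that of $\pi$.) 4. *Budgeted LCS.* Compute a common subsequence $L$ of $\pi$ and $\rho$, where an entry $p$ of $\pi$ may be matched with any copy of $t_p$ and at most $k$ matches use a copy $t_p^{(\ell)}$ with $\ell\ge 1$, by the dynamic program with value $S(i,j,b)$ for the first $i$ entries of $\pi$, the first $j$ entries of $\rho$ and budget $b$: $S(i,j,b)=0$ if $i=0$ or $j=0$; otherwise, with $p=\pi(i)$, - if $\rho(j)=t_p^{(\ell)}$ with $\ell\ge1$ and $b>0$: $S(i,j,b)=\max\{1+S(i-1,j-1,b-1),\,S(i,j-1,b)\}$; - if $\rho(j)=t_p^{(0)}$: $S(i,j,b)=1+S(i-1,j-1,b)$; - in all other cases: $S(i,j,b)=\max\{S(i,j-1,b),\,S(i-1,j,b)\}$. $L$ is a subsequence that attains $S(n,(g+1)n,k)$, recorded along the recurrence. 5. *Output.* Starting from length $0$ and null, keep the pair $(u,L)$ whenever $L$ is strictly longer than the longest one so far. For the final pair return $w=(u_1,\dots,u_d)$,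 $v_i=u_{d+i}$ and $G_i=\{t_p: t_p^{(i)}\text{ occurs in }L\}$; return null if no pair was kept. **Theorem.** If the instance $(t,\pi,k)$ has a solution, then MGRA returns one: an execution exists, and every execution, whatever the order of the cells and the vectors chosen from them, returns a solution $(w,v,G_1,\dots,G_g)$ of $(t,\pi,k)$; moreover all its bonuses are positive. -/

import Mathlib

namespace MGRA

/-! ### The ranking problem

The tuples are `t p : Fin d → ℝ` for `p : Fin n`. A ranking is a permutation `π` of `Fin n`, where
`π a` is the tuple at position `a` and position `0` is the top. -/

/-- Weights, one bonus per group, and the groups. -/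
structure Scheme (n d g : ℕ) where
  weight : Fin d → ℝ
  bonus : Fin g → ℝ
  group : Fin g → Finset (Fin n)

/-- The score of tuple `p`: the linear utility plus the bonus of the group that contains `p`
(no bonus if there is none). -/
noncomputable def Scheme.score {n d g : ℕ} (S : Scheme n d g) (t : Fin n → Fin d → ℝ)
    (p : Fin n) : ℝ :=
  (∑ j, S.weight j * t p j) + ∑ i, if p ∈ S.group i then S.bonus i else 0

/-- The scheme solves the instance `(t, π, k)` of `g`-group bonus linear ranking: the bonuses are
nonnegative, the groups are disjoint and have at most `k` members in total, and sorting by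
decreasing score produces `π`. -/
structure Scheme.IsSolution {n d g : ℕ} (S : Scheme n d g) (t : Fin n → Fin d → ℝ)
    (π : Equiv.Perm (Fin n)) (k : ℕ) : Prop where
  bonus_nonneg : ∀ i, 0 ≤ S.bonus i
  disjoint : ∀ i i', i ≠ i' → Disjoint (S.group i) (S.group i')
  size_le : ∑ i, (S.group i).card ≤ k
  realizes : ∀ a b : Fin n, a < b → S.score t (π b) < S.score t (π a)

/-! ### The lifted data set and its comparison hyperplanes -/

/-- The lifted data set: `(p, 0)` is the copy of `p` without bonus, and `(p, i.succ)` is the copy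
of `p` as a member of group `i`. -/
abbrev Copy (n g : ℕ) : Type := Fin n × Fin (g + 1)

/-- The `d` attributes of the tuple, followed by one bonus coordinate per group. -/
def liftTuple {n d g : ℕ} (t : Fin n → Fin d → ℝ) (c : Copy n g) : Fin (d + g) → ℝ :=
  Fin.append (t c.1) (fun i => if c.2 = i.succ then 1 else 0)

/-- The score of a copy for the weight vector `u` in dimension `d + g`. -/
def liftScore {n d g : ℕ} (t : Fin n → Fin d → ℝ) (u : Fin (d + g) → ℝ) (c : Copy n g) : ℝ :=
  u ⬝ᵥ liftTuple t c

/-- The comparison hyperplanes of all pairs of copies. A pair of copies with equal vectors (they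
come from two tuples with the same attributes) has no hyperplane. -/
def hyperplanes {n d g : ℕ} (t : Fin n → Fin d → ℝ) : Set (Set (Fin (d + g) → ℝ)) :=
  {H | ∃ a b : Copy n g, liftTuple t a ≠ liftTuple t b ∧
    H = {u | liftScore t u a = liftScore t u b}}

/-- The location vector of `u`: which copy of each ordered pair scores better. -/
def location {n d g : ℕ} (t : Fin n → Fin d → ℝ) (u : Fin (d + g) → ℝ) :
    Copy n g → Copy n g → Prop :=
  fun a b => liftScore t u b < liftScore t u a

/-- The cells of the arrangement: the nonempty sets of all the vectors off the hyperplanes that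
have a given location vector. -/
def cells {n d g : ℕ} (t : Fin n → Fin d → ℝ) : Set (Set (Fin (d + g) → ℝ)) :=
  {C | C.Nonempty ∧ ∃ l : Copy n g → Copy n g → Prop,
    C = {u | (∀ H ∈ hyperplanes t, u ∉ H) ∧ location t u = l}}

/-- The cells in which every bonus coordinate is positive. -/
def bonusCells {n d g : ℕ} (t : Fin n → Fin d → ℝ) : Set (Set (Fin (d + g) → ℝ)) :=
  {C ∈ cells t | ∀ u ∈ C, ∀ i : Fin g, 0 < u (Fin.natAdd d i)}

/-- The list `us` is a possible result of the enumeration of the cells: it holds one weight vector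
from each cell with positive bonus coordinates, the cells being taken in any order. -/
def IsEnumeration {n d g : ℕ} (t : Fin n → Fin d → ℝ) (us : List (Fin (d + g) → ℝ)) : Prop :=
  ∃ Cs : List (Set (Fin (d + g) → ℝ)),
    Cs.Nodup ∧ (∀ C, C ∈ Cs ↔ C ∈ bonusCells t) ∧ List.Forall₂ (fun u C => u ∈ C) us Cs

open Classical in
/-- The ranking of the lifted data set by decreasing score. On a cell only copies with equal
vectors tie (never, if the tuples are distinct); they are listed against `π`. -/
noncomputable def liftRanking {n d g : ℕ} (t : Fin n → Fin d → ℝ) (π : Equiv.Perm (Fin n))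
    (u : Fin (d + g) → ℝ) : List (Copy n g) :=
  (Finset.univ : Finset (Copy n g)).toList.mergeSort fun a b =>
    decide (liftScore t u b < liftScore t u a ∨
      (liftScore t u a = liftScore t u b ∧ π.symm b.1 ≤ π.symm a.1))

/-! ### The budgeted longest common subsequence -/

/-- The longer of two lists. -/
def longer {α : Type*} (l m : List α) : List α :=
  if l.length < m.length then m else l

/-- The recurrence of the dynamic program. The lists hold the first `i` entries of the target
ranking and the first `j` entries of the ranking of the copies, the last entry at the head; `b` is
the budget that is left. An entry `p` of the former matches every copy of `p`, and a match with
a copy that carries a bonus costs one unit. The value is a table entry, kept with the common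
subsequence that attains it. -/
def solve {n g : ℕ} : List (Fin n) → List (Copy n g) → ℕ → List (Copy n g)
  | [], _, _ => []
  | _ :: _, [], _ => []
  | p :: ps, q :: qs, b =>
    if q.1 = p ∧ q.2 ≠ 0 ∧ 0 < b then
      longer (q :: solve ps qs (b - 1)) (solve (p :: ps) qs b)
    else if q.1 = p ∧ q.2 = 0 then
      q :: solve ps qs b
    else
      longer (solve (p :: ps) qs b) (solve ps (q :: qs) b)
  termination_by ps qs _ => ps.length + qs.length

/-- The budgeted longest common subsequence of the target ranking `π` and the ranking `ρ` of the
copies, as the list of the matched copies. -/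
def multipleGroupLCS {n g : ℕ} (π : Equiv.Perm (Fin n)) (ρ : List (Copy n g)) (k : ℕ) :
    List (Copy n g) :=
  (solve (List.ofFn π).reverse ρ.reverse k).reverse

/-! ### The algorithm -/

/-- One round of the main loop. The state is the greatest length so far, with the weight vector
and the common subsequence that attain it. -/
noncomputable def round {n d g : ℕ} (t : Fin n → Fin d → ℝ) (π : Equiv.Perm (Fin n)) (k : ℕ)
    (s : ℕ × Option ((Fin (d + g) → ℝ) × List (Copy n g))) (u : Fin (d + g) → ℝ) :
    ℕ × Option ((Fin (d + g) → ℝ) × List (Copy n g)) :=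
  if s.1 < (multipleGroupLCS π (liftRanking t π u) k).length then
    ((multipleGroupLCS π (liftRanking t π u) k).length,
      some (u, multipleGroupLCS π (liftRanking t π u) k))
  else s

/-- The weights are the first `d` coordinates of `u`, the bonuses are the others, and group `i`
consists of the tuples that are matched through their copy number `i`. -/
def readOff {n d g : ℕ} (u : Fin (d + g) → ℝ) (L : List (Copy n g)) : Scheme n d g where
  weight j := u (Fin.castAdd g j)
  bonus i := u (Fin.natAdd d i)
  group i := Finset.univ.filter fun p => (p, i.succ) ∈ L

/-- The main loop over the enumerated weight vectors `us`, and its output (`none` for null). -/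
noncomputable def run {n d g : ℕ} (t : Fin n → Fin d → ℝ) (π : Equiv.Perm (Fin n)) (k : ℕ)
    (us : List (Fin (d + g) → ℝ)) : Option (Scheme n d g) :=
  (us.foldl (round t π k) (0, none)).2.map fun r => readOff r.1 r.2

/-- `out` is what the algorithm returns on `(t, π, k)` with `g` groups in one of its executions;
these differ in the order of the cells and in the vectors chosen from them. -/
def Returns {n d g : ℕ} (t : Fin n → Fin d → ℝ) (π : Equiv.Perm (Fin n)) (k : ℕ)
    (out : Option (Scheme n d g)) : Prop :=
  ∃ us : List (Fin (d + g) → ℝ), IsEnumeration t us ∧ out = run t π k us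

end MGRA

/-! Whether a choice of one copy per tuple is ranked as `π` prescribes depends only on the location
vector, so one vector per cell decides. A solution selects such copies, and its weights and bonuses
score them in the strict order of `π`. Strictness is an open condition, so this vector can be moved
to make all bonuses positive and to leave the finitely many hyperplanes. The representative of the
cell reached ranks these copies alike, and they form a common subsequence of length `n` within the
budget. The dynamic program finds such full matches (`length_le_length_solve`), so the loop ends
with length `n` (`Scheme.IsSolution.exists_mem_enumeration`, `foldl_round_spec`).

Conversely, a common subsequence of length `n` within the budget reads off as a solution
(`isSolution_readOff`), whichever cell it comes from. -/

namespace MGRA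

open scoped List

/-! ### The dynamic program -/

/-- The number of matches that consume budget. -/
def cost {n g : ℕ} (L : List (Copy n g)) : ℕ := L.countP fun c => decide (c.2 ≠ 0)

theorem longer_eq_or {α : Type*} (l m : List α) : longer l m = l ∨ longer l m = m := by
  unfold longer
  split_ifs <;> simp

theorem le_length_longer_left {α : Type*} (l m : List α) : l.length ≤ (longer l m).length := by
  unfold longer
  split_ifs <;> omega

theorem le_length_longer_right {α : Type*} (l m : List α) : m.length ≤ (longer l m).length := by
  unfold longer
  split_ifs <;> omega

/-- Translates between the budget and the group sizes, for the given solution and for the output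
alike. -/
theorem cost_eq_sum_card {n g : ℕ} {L : List (Copy n g)} (hL : L.Nodup) :
    cost L = ∑ i : Fin g, (Finset.univ.filter fun p => (p, i.succ) ∈ L).card := by
  have h : cost L = (L.toFinset.filter fun c => c.2 ≠ 0).card := by
    rw [cost, List.countP_eq_length_filter, ← List.toFinset_card_of_nodup (hL.filter _),
      List.toFinset_filter]
    simp
  rw [h, Finset.card_eq_sum_card_fiberwise (f := Prod.snd) (t := Finset.univ) (by simp),
    Fin.sum_univ_succ, Finset.card_eq_zero.2 (by ext; simp), zero_add]
  refine Finset.sum_congr rfl fun i _ => ?_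
  rw [← Finset.card_map ⟨fun p : Fin n => (p, i.succ), fun p q e => congrArg Prod.fst e⟩]
  congr 1
  ext ⟨p, j⟩
  simp only [Finset.mem_filter, Finset.mem_map, Finset.mem_univ, List.mem_toFinset, true_and]
  constructor
  · rintro ⟨⟨hc, -⟩, rfl⟩
    exact ⟨p, hc, rfl⟩
  · rintro ⟨q, hc, e⟩
    obtain ⟨rfl, rfl⟩ := Prod.mk.inj e
    exact ⟨⟨hc, Fin.succ_ne_zero i⟩, rfl⟩

/-- The dynamic program returns a common subsequence within the budget. -/
theorem solve_sound {n g : ℕ} (ps : List (Fin n)) (qs : List (Copy n g)) (b : ℕ) :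
    (solve ps qs b).map Prod.fst <+ ps ∧ solve ps qs b <+ qs ∧ cost (solve ps qs b) ≤ b := by
  fun_induction solve ps qs b with
  | case1 => simp [cost]
  | case2 => simp [cost]
  | case3 p ps q qs b h ih₁ ih₂ =>
    rcases longer_eq_or (q :: solve ps qs (b - 1)) (solve (p :: ps) qs b) with e | e <;> rw [e]
    · obtain ⟨h₁, h₂, h₃⟩ := ih₁
      refine ⟨?_, h₂.cons_cons q, ?_⟩
      · rw [List.map_cons, h.1]
        exact h₁.cons_cons p
      · unfold cost at *
        rw [List.countP_cons_of_pos (by simp [h.2.1])]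
        omega
    · exact ⟨ih₂.1, ih₂.2.1.cons q, ih₂.2.2⟩
  | case4 p ps q qs b h h' ih =>
    obtain ⟨h₁, h₂, h₃⟩ := ih
    refine ⟨?_, h₂.cons_cons q, ?_⟩
    · rw [List.map_cons, h'.1]
      exact h₁.cons_cons p
    · unfold cost at *
      rw [List.countP_cons_of_neg (by simp [h'.2])]
      exact h₃
  | case5 p ps q qs b h h' ih₁ ih₂ =>
    rcases longer_eq_or (solve (p :: ps) qs b) (solve ps (q :: qs) b) with e | e <;> rw [e]
    · exact ⟨ih₁.1, ih₁.2.1.cons q, ih₁.2.2⟩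
    · exact ⟨ih₂.1.cons p, ih₂.2.1, ih₂.2.2⟩

/-- If the whole first list can be matched within the budget, the dynamic program does so. -/
theorem length_le_length_solve {n g : ℕ} (ps : List (Fin n)) (qs : List (Copy n g)) (b : ℕ)
    (L : List (Copy n g)) (hp : L.map Prod.fst = ps) (hq : L <+ qs) (hb : cost L ≤ b) :
    ps.length ≤ (solve ps qs b).length := by
  fun_induction solve ps qs b generalizing L with
  | case1 => simp
  | case2 => simp_all
  | case3 p ps q qs b h ih₁ ih₂ =>
    cases hq with
    | cons _ hq => exact (ih₂ L hp hq hb).trans (le_length_longer_right _ _)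
    | cons_cons _ hq =>
      rename_i M
      refine le_trans ?_ (le_length_longer_left _ _)
      rw [List.map_cons, List.cons.injEq] at hp
      have := ih₁ M hp.2 hq (by
        unfold cost at *
        rw [List.countP_cons_of_pos (by simp [h.2.1])] at hb
        omega)
      simpa using this
  | case4 p ps q qs b h h' ih =>
    cases L with
    | nil => simp at hp
    | cons c M =>
      rw [List.map_cons, List.cons.injEq] at hp
      -- Taking the free copy `q` loses nothing: even if `L` skips `q`, its tail `M` still embeds in
      -- `qs`, at no greater cost.
      have hM : M <+ qs := by
        cases hq with
        | cons _ hq => exact (List.sublist_cons_self c M).trans hq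
        | cons_cons _ hq => exact hq
      have := ih M hp.2 hM ((List.sublist_cons_self c M).countP_le.trans hb)
      simpa using this
  | case5 p ps q qs b h h' ih₁ ih₂ =>
    refine le_trans ?_ (le_length_longer_left _ _)
    cases hq with
    | cons _ hq => exact ih₁ L hp hq hb
    | cons_cons _ hq =>
      rename_i M
      rw [List.map_cons, List.cons.injEq] at hp
      -- `L` starts with a copy of `p`, so this branch is reached only with a paid copy and no
      -- budget, which contradicts `hb`.
      by_cases h0 : q.2 = 0
      · exact absurd ⟨hp.1, h0⟩ h'
      · have hb0 : b = 0 := by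
          by_contra hb0
          exact h ⟨hp.1, h0, Nat.pos_of_ne_zero hb0⟩
        unfold cost at hb
        rw [List.countP_cons_of_pos (by simp [h0])] at hb
        omega

theorem cost_reverse {n g : ℕ} (L : List (Copy n g)) : cost L.reverse = cost L := by
  simp [cost]

theorem multipleGroupLCS_sound {n g : ℕ} (π : Equiv.Perm (Fin n)) (ρ : List (Copy n g)) (k : ℕ) :
    (multipleGroupLCS π ρ k).map Prod.fst <+ List.ofFn π ∧ multipleGroupLCS π ρ k <+ ρ ∧
      cost (multipleGroupLCS π ρ k) ≤ k := by
  obtain ⟨h₁, h₂, h₃⟩ := solve_sound (List.ofFn π).reverse ρ.reverse k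
  refine ⟨?_, ?_, ?_⟩
  · rw [multipleGroupLCS, List.map_reverse]
    simpa using h₁.reverse
  · simpa [multipleGroupLCS] using h₂.reverse
  · rwa [multipleGroupLCS, cost_reverse]

theorem le_length_multipleGroupLCS {n g : ℕ} (π : Equiv.Perm (Fin n)) (ρ : List (Copy n g))
    (k : ℕ) (L : List (Copy n g)) (hp : L.map Prod.fst = List.ofFn π) (hq : L <+ ρ)
    (hb : cost L ≤ k) : n ≤ (multipleGroupLCS π ρ k).length := by
  have := length_le_length_solve (List.ofFn π).reverse ρ.reverse k L.reverse
    (by rw [List.map_reverse, hp]) hq.reverse (by rwa [cost_reverse])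
  simpa [multipleGroupLCS] using this

/-! ### The ranking of the copies -/

theorem pairwise_liftRanking {n d g : ℕ} (t : Fin n → Fin d → ℝ) (π : Equiv.Perm (Fin n))
    (u : Fin (d + g) → ℝ) :
    (liftRanking t π u : List (Copy n g)).Pairwise fun a b =>
      liftScore t u b < liftScore t u a ∨
        (liftScore t u a = liftScore t u b ∧ π.symm b.1 ≤ π.symm a.1) := by
  classical
  have := List.pairwise_mergeSort (le := fun a b : Copy n g =>
      decide (liftScore t u b < liftScore t u a ∨
        (liftScore t u a = liftScore t u b ∧ π.symm b.1 ≤ π.symm a.1)))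
    (by
      intro a b c hab hbc
      simp only [decide_eq_true_eq] at *
      rcases hab with hab | ⟨hab, hab'⟩ <;> rcases hbc with hbc | ⟨hbc, hbc'⟩
      · exact Or.inl (hbc.trans hab)
      · exact Or.inl (hbc ▸ hab)
      · exact Or.inl (hab ▸ hbc)
      · exact Or.inr ⟨hab.trans hbc, hbc'.trans hab'⟩)
    (by
      intro a b
      simp only [Bool.or_eq_true, decide_eq_true_eq]
      rcases lt_trichotomy (liftScore t u a) (liftScore t u b) with h | h | h
      · exact Or.inr (Or.inl h)
      · rcases le_total (π.symm b.1) (π.symm a.1) with h' | h'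
        · exact Or.inl (Or.inr ⟨h, h'⟩)
        · exact Or.inr (Or.inr ⟨h.symm, h'⟩)
      · exact Or.inl (Or.inl h))
    (Finset.univ : Finset (Copy n g)).toList
  refine List.Pairwise.imp ?_ this
  intro a b h
  simpa only [decide_eq_true_eq] using h

theorem mem_liftRanking {n d g : ℕ} (t : Fin n → Fin d → ℝ) (π : Equiv.Perm (Fin n))
    (u : Fin (d + g) → ℝ) (c : Copy n g) : c ∈ liftRanking t π u := by
  simp [liftRanking]

/-- A list that is strictly ordered is a subsequence of every ordered list that contains it. -/
theorem sublist_of_pairwise {α : Type*} {r s : α → α → Prop} (hrs : ∀ a b, s a b → ¬ r b a)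
    (hs : ∀ a, ¬ s a a) (l L : List α) (hl : l.Pairwise r) (hL : L.Pairwise s) (h : L ⊆ l) :
    L <+ l := by
  induction l generalizing L with
  | nil => rw [List.subset_nil.1 h]
  | cons x l ih =>
    cases L with
    | nil => simp
    | cons y M =>
      rw [List.pairwise_cons] at hl hL
      by_cases hyx : y = x
      · subst hyx
        refine List.Sublist.cons_cons y (ih M hl.2 hL.2 fun z hz => ?_)
        rcases List.mem_cons.1 (h (List.mem_cons_of_mem y hz)) with rfl | hz'
        · exact absurd (hL.1 _ hz) (hs _)
        · exact hz'
      · have hy : y ∈ l := (List.mem_cons.1 (h List.mem_cons_self)).resolve_left hyx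
        refine List.Sublist.cons x (ih _ hl.2 (List.pairwise_cons.2 hL) fun z hz => ?_)
        rcases List.mem_cons.1 (h hz) with rfl | hz'
        · rcases List.mem_cons.1 hz with rfl | hz'
          · exact absurd rfl hyx
          -- The head of `l` would come after `y` in `L` but before `y` in `l`.
          · exact absurd (hl.1 y hy) (hrs _ _ (hL.1 _ hz'))
        · exact hz'

/-! ### Scores of copies -/

theorem liftScore_eq {n d g : ℕ} (t : Fin n → Fin d → ℝ) (u : Fin (d + g) → ℝ) (c : Copy n g) :
    liftScore t u c = (∑ j, u (Fin.castAdd g j) * t c.1 j) +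
      ∑ i, if c.2 = i.succ then u (Fin.natAdd d i) else 0 := by
  simp [liftScore, liftTuple, dotProduct, Fin.sum_univ_add]

theorem liftScore_succ_sub_zero {n d g : ℕ} (t : Fin n → Fin d → ℝ) (u : Fin (d + g) → ℝ)
    (p : Fin n) (i : Fin g) :
    liftScore t u (p, i.succ) = liftScore t u (p, 0) + u (Fin.natAdd d i) := by
  simp [liftScore_eq, (Fin.succ_ne_zero _).symm]

theorem continuous_liftScore {n d g : ℕ} (t : Fin n → Fin d → ℝ) (c : Copy n g) :
    Continuous fun u : Fin (d + g) → ℝ => liftScore t u c := by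
  unfold liftScore dotProduct
  fun_prop

/-! ### The arrangement -/

theorem finite_bonusCells {n d g : ℕ} (t : Fin n → Fin d → ℝ) :
    (bonusCells t : Set (Set (Fin (d + g) → ℝ))).Finite := by
  refine (Set.finite_range fun l : Copy n g → Copy n g → Prop =>
    {u : Fin (d + g) → ℝ | (∀ H ∈ hyperplanes t, u ∉ H) ∧ location t u = l}).subset ?_
  rintro C ⟨⟨-, l, rfl⟩, -⟩
  exact ⟨l, rfl⟩

theorem exists_isEnumeration {n d g : ℕ} (t : Fin n → Fin d → ℝ) :
    ∃ us : List (Fin (d + g) → ℝ), IsEnumeration t us := by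
  classical
  have hne : ∀ C : Set (Fin (d + g) → ℝ), ∃ u, C ∈ bonusCells t → u ∈ C := by
    intro C
    by_cases hC : C ∈ bonusCells t
    · obtain ⟨u, hu⟩ := hC.1.1
      exact ⟨u, fun _ => hu⟩
    · exact ⟨0, fun h => absurd h hC⟩
  choose f hf using hne
  refine ⟨(finite_bonusCells t).toFinset.toList.map f, (finite_bonusCells t).toFinset.toList,
    Finset.nodup_toList _, by simp, ?_⟩
  rw [List.forall₂_map_left_iff, List.forall₂_same]
  intro C hC
  exact hf C (by simpa using hC)

theorem IsEnumeration.bonus_pos {n d g : ℕ} {t : Fin n → Fin d → ℝ}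
    {us : List (Fin (d + g) → ℝ)} (h : IsEnumeration t us) {u : Fin (d + g) → ℝ} (hu : u ∈ us)
    (i : Fin g) : 0 < u (Fin.natAdd d i) := by
  obtain ⟨Cs, -, hC, hF⟩ := h
  obtain ⟨m, hm, rfl⟩ := List.getElem_of_mem hu
  have hm' : m < Cs.length := hF.length_eq ▸ hm
  exact ((hC Cs[m]).1 (List.getElem_mem hm')).2 _ (hF.get hm hm') i

/-- Off the hyperplanes, each vector with positive bonuses shares its location vector with one of
the enumerated vectors. -/
theorem IsEnumeration.exists_location_eq {n d g : ℕ} (hn : 0 < n) {t : Fin n → Fin d → ℝ}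
    {us : List (Fin (d + g) → ℝ)} (h : IsEnumeration t us) {u : Fin (d + g) → ℝ}
    (hu : ∀ H ∈ hyperplanes t, u ∉ H) (hpos : ∀ i : Fin g, 0 < u (Fin.natAdd d i)) :
    ∃ u' ∈ us, location t u' = location t u := by
  obtain ⟨Cs, -, hC, hF⟩ := h
  have hmem : {u' : Fin (d + g) → ℝ |
      (∀ H ∈ hyperplanes t, u' ∉ H) ∧ location t u' = location t u} ∈ Cs := by
    refine (hC _).2 ⟨⟨⟨u, hu, rfl⟩, location t u, rfl⟩, ?_⟩
    rintro u' ⟨-, hloc⟩ i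
    -- The sign of a bonus is visible in the location vector, by comparing two copies of one tuple;
    -- hence it is constant on a cell.
    have key : location t u (⟨0, hn⟩, i.succ) (⟨0, hn⟩, 0) := by
      rw [location, liftScore_succ_sub_zero]
      linarith [hpos i]
    rw [← hloc, location, liftScore_succ_sub_zero] at key
    linarith
  obtain ⟨m, hm, hCm⟩ := List.getElem_of_mem hmem
  have hm' : m < us.length := hF.length_eq ▸ hm
  have := hF.get hm' hm
  simp only [List.get_eq_getElem, hCm] at this
  exact ⟨us[m], List.getElem_mem hm', this.2⟩

/-- From a point of the hyperplane, a step `s • z` along the normal `z` makes the score difference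
`s * (z ⬝ᵥ z)`, nonzero for `s ≠ 0`. -/
theorem dense_ne_liftScore {n d g : ℕ} (t : Fin n → Fin d → ℝ) (a b : Copy n g)
    (hab : liftTuple t a ≠ liftTuple t b) :
    Dense {u : Fin (d + g) → ℝ | liftScore t u a ≠ liftScore t u b} := by
  set z := liftTuple t a - liftTuple t b with hz
  have hz0 : z ≠ 0 := sub_ne_zero.2 hab
  have hzz : z ⬝ᵥ z ≠ 0 := fun h => hz0 (dotProduct_self_eq_zero.1 h)
  have hiff : ∀ u : Fin (d + g) → ℝ, liftScore t u a ≠ liftScore t u b ↔ u ⬝ᵥ z ≠ 0 := by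
    intro u
    rw [hz, dotProduct_sub, sub_ne_zero]
    rfl
  simp only [hiff]
  intro u
  by_cases hu : u ⬝ᵥ z = 0
  · have hlim : Filter.Tendsto (fun s : ℝ => u + s • z) (nhdsWithin 0 {0}ᶜ) (nhds u) := by
      have : Continuous fun s : ℝ => u + s • z := by fun_prop
      simpa using (this.tendsto 0).mono_left nhdsWithin_le_nhds
    refine mem_closure_of_tendsto hlim ?_
    filter_upwards [self_mem_nhdsWithin] with s hs
    simp only [add_dotProduct, smul_dotProduct, hu, zero_add, smul_eq_mul]
    exact mul_ne_zero hs hzz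
  · exact subset_closure hu

theorem dense_off_hyperplanes {n d g : ℕ} (t : Fin n → Fin d → ℝ) :
    Dense {u : Fin (d + g) → ℝ | ∀ H ∈ (hyperplanes t : Set (Set (Fin (d + g) → ℝ))), u ∉ H} := by
  have hd : Dense (⋂ x : {x : Copy n g × Copy n g // liftTuple t x.1 ≠ liftTuple t x.2},
      {u : Fin (d + g) → ℝ | liftScore t u x.1.1 ≠ liftScore t u x.1.2}) :=
    dense_iInter_of_isOpen
      (fun x => isOpen_ne_fun (continuous_liftScore t _) (continuous_liftScore t _))
      (fun x => dense_ne_liftScore t _ _ x.2)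
  refine hd.mono ?_
  rintro u hu H ⟨a, b, hab, rfl⟩
  exact Set.mem_iInter.1 hu ⟨(a, b), hab⟩

/-! ### From a solution to a cell -/

open Classical in
/-- The copy of `p` that a scheme uses. -/
noncomputable def Scheme.copy {n d g : ℕ} (S : Scheme n d g) (p : Fin n) : Copy n g :=
  (p, if h : ∃ i, p ∈ S.group i then h.choose.succ else 0)

/-- Disjointness leaves `choose` only one group to pick. -/
theorem Scheme.copy_snd_eq_succ_iff {n d g : ℕ} {S : Scheme n d g}
    (hS : ∀ i i', i ≠ i' → Disjoint (S.group i) (S.group i')) (p : Fin n) (i : Fin g) :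
    (S.copy p).2 = i.succ ↔ p ∈ S.group i := by
  unfold Scheme.copy
  by_cases h : ∃ i, p ∈ S.group i
  · simp only [h, dif_pos, Fin.succ_inj]
    refine ⟨fun e => e ▸ h.choose_spec, fun hi => ?_⟩
    by_contra hne
    exact Finset.disjoint_left.1 (hS _ _ hne) h.choose_spec hi
  · simp only [h, dif_neg, not_false_eq_true, (Fin.succ_ne_zero _).symm, false_iff]
    exact fun hi => h ⟨i, hi⟩

/-- The weights of the scheme followed by its bonuses. -/
def Scheme.vector {n d g : ℕ} (S : Scheme n d g) : Fin (d + g) → ℝ :=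
  Fin.append S.weight S.bonus

theorem Scheme.liftScore_copy {n d g : ℕ} {S : Scheme n d g}
    (hS : ∀ i i', i ≠ i' → Disjoint (S.group i) (S.group i')) (t : Fin n → Fin d → ℝ)
    (p : Fin n) : liftScore t S.vector (S.copy p) = S.score t p := by
  rw [liftScore_eq, Scheme.score]
  simp only [Scheme.copy_snd_eq_succ_iff hS, Scheme.vector, Fin.append_left, Fin.append_right]
  rfl

theorem Scheme.cost_map_copy {n d g : ℕ} {S : Scheme n d g}
    (hS : ∀ i i', i ≠ i' → Disjoint (S.group i) (S.group i')) (π : Equiv.Perm (Fin n)) :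
    cost (List.ofFn fun a => S.copy (π a)) = ∑ i, (S.group i).card := by
  classical
  rw [cost_eq_sum_card (List.nodup_ofFn.2 fun a b e => π.injective (congrArg Prod.fst e))]
  refine Finset.sum_congr rfl fun i _ => congrArg Finset.card ?_
  ext p
  rw [Finset.mem_filter_univ, List.mem_ofFn, ← Scheme.copy_snd_eq_succ_iff hS]
  constructor
  · rintro ⟨a, e⟩
    obtain rfl : π a = p := congrArg Prod.fst e
    rw [e]
  · intro e
    exact ⟨π.symm p, by rw [Equiv.apply_symm_apply]; exact Prod.ext rfl e⟩

/-- Every solution yields a vector off the hyperplanes, with positive bonuses, that ranks the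
copies used by the solution as `π` ranks the tuples. -/
theorem Scheme.IsSolution.exists_vector {n d g k : ℕ} {t : Fin n → Fin d → ℝ}
    {π : Equiv.Perm (Fin n)} {S : Scheme n d g} (hS : S.IsSolution t π k) :
    ∃ u : Fin (d + g) → ℝ, (∀ H ∈ hyperplanes t, u ∉ H) ∧
      (∀ i : Fin g, 0 < u (Fin.natAdd d i)) ∧
      ∀ a b : Fin n, a < b → location t u (S.copy (π a)) (S.copy (π b)) := by
  let U : Set (Fin (d + g) → ℝ) := ⋂ x : {x : Fin n × Fin n // x.1 < x.2},
    {u | liftScore t u (S.copy (π x.1.2)) < liftScore t u (S.copy (π x.1.1))}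
  have hU : IsOpen U := isOpen_iInter_of_finite fun x =>
    isOpen_lt (continuous_liftScore t _) (continuous_liftScore t _)
  have hSU : S.vector ∈ U := by
    refine Set.mem_iInter.2 fun x => ?_
    simp only [Set.mem_ofPred_eq, Scheme.liftScore_copy hS.disjoint]
    exact hS.realizes _ _ x.2
  let V : Set (Fin (d + g) → ℝ) := ⋂ i : Fin g, {u | 0 < u (Fin.natAdd d i)}
  have hV : IsOpen V := isOpen_iInter_of_finite fun i =>
    isOpen_lt continuous_const (continuous_apply _)
  have hUV : (U ∩ V).Nonempty := by
    -- Bonuses of `S` may vanish. Adding a small `s > 0` to every coordinate makes them positive;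
    -- the weights shift too, harmlessly since `U` is open.
    have hlim : Filter.Tendsto (fun s : ℝ => S.vector + fun _ => s) (nhdsWithin 0 (Set.Ioi 0))
        (nhds S.vector) := by
      have : Continuous fun s : ℝ => S.vector + fun _ => s := by fun_prop
      have h0 := (this.tendsto 0).mono_left (nhdsWithin_le_nhds (s := Set.Ioi 0))
      have e : (S.vector + fun _ => (0 : ℝ)) = S.vector := add_zero _
      rwa [e] at h0
    obtain ⟨s, hsU, hs⟩ := ((hlim.eventually (hU.mem_nhds hSU)).and self_mem_nhdsWithin).exists
    refine ⟨_, hsU, Set.mem_iInter.2 fun i => ?_⟩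
    simp only [Set.mem_ofPred_eq, Pi.add_apply, Scheme.vector, Fin.append_right]
    exact add_pos_of_nonneg_of_pos (hS.bonus_nonneg i) hs
  obtain ⟨u, hu, huU, huV⟩ :=
    (dense_off_hyperplanes (g := g) t).exists_mem_open (hU.inter hV) hUV
  exact ⟨u, hu, Set.mem_iInter.1 huV, fun a b hab => Set.mem_iInter.1 huU ⟨(a, b), hab⟩⟩

theorem Scheme.IsSolution.exists_mem_enumeration {n d g k : ℕ} (hn : 0 < n)
    {t : Fin n → Fin d → ℝ} {π : Equiv.Perm (Fin n)} {S : Scheme n d g}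
    (hS : S.IsSolution t π k) {us : List (Fin (d + g) → ℝ)} (hus : IsEnumeration t us) :
    ∃ u ∈ us, n ≤ (multipleGroupLCS π (liftRanking t π u) k).length := by
  obtain ⟨u₀, hoff, hpos, hloc⟩ := hS.exists_vector
  obtain ⟨u, hu, he⟩ := hus.exists_location_eq hn hoff hpos
  refine ⟨u, hu, le_length_multipleGroupLCS π _ k (List.ofFn fun a => S.copy (π a)) ?_ ?_ ?_⟩
  · rw [List.map_ofFn]
    rfl
  · refine sublist_of_pairwise (s := fun a b => location t u a b) ?_
      (fun a => lt_irrefl (liftScore t u a)) _ _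
      (pairwise_liftRanking t π u) ?_ fun c _ => mem_liftRanking t π u c
    · rintro a b hab (h | ⟨h, -⟩)
      · exact lt_asymm hab h
      · exact hab.ne h
    · rw [List.pairwise_ofFn]
      intro a b hab
      rw [he]
      exact hloc a b hab
  · rw [Scheme.cost_map_copy hS.disjoint]
    exact hS.size_le

/-! ### From a full common subsequence to a solution -/

/-- Each tuple occurs in `L` through exactly one copy, so the groups are disjoint and its score is
that of its copy. -/
theorem isSolution_readOff {n d g k : ℕ} {t : Fin n → Fin d → ℝ} {π : Equiv.Perm (Fin n)}
    {u : Fin (d + g) → ℝ} (hu : ∀ i : Fin g, 0 < u (Fin.natAdd d i)) {L : List (Copy n g)}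
    (hp : L.map Prod.fst = List.ofFn π) (hq : L <+ liftRanking t π u) (hb : cost L ≤ k) :
    (readOff u L).IsSolution t π k := by
  have hlen : L.length = n := by simpa using congrArg List.length hp
  have hfst : ∀ (a : ℕ) (ha : a < L.length), L[a].1 = π ⟨a, hlen ▸ ha⟩ := by
    intro a ha
    have := List.getElem_of_eq hp (i := a) (by simpa using ha)
    simpa using this
  have huniq : ∀ c ∈ L, ∀ c' ∈ L, c.1 = c'.1 → c = c' := by
    intro c hc c' hc' e
    obtain ⟨a, ha, rfl⟩ := List.getElem_of_mem hc
    obtain ⟨b, hb, rfl⟩ := List.getElem_of_mem hc'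
    rw [hfst, hfst] at e
    have : a = b := by simpa using π.injective e
    subst this
    rfl
  have hmem : ∀ (c : Copy n g), c ∈ L → ∀ i : Fin g,
      c.1 ∈ (readOff u L).group i ↔ c.2 = i.succ := by
    intro c hc i
    simp only [readOff, Finset.mem_filter, Finset.mem_univ, true_and]
    refine ⟨fun h => congrArg Prod.snd (huniq c hc _ h rfl), fun h => ?_⟩
    rw [← h]
    exact hc
  have hscore : ∀ c ∈ L, (readOff u L).score t c.1 = liftScore t u c := by
    intro c hc
    rw [liftScore_eq, Scheme.score]
    simp only [hmem c hc]
    rfl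
  refine ⟨fun i => (hu i).le, ?_, ?_, ?_⟩
  · intro i i' hne
    refine Finset.disjoint_left.2 fun p h h' => hne ?_
    simp only [readOff, Finset.mem_filter, Finset.mem_univ, true_and] at h h'
    exact Fin.succ_injective _ (congrArg Prod.snd (huniq _ h _ h' rfl))
  · rw [cost_eq_sum_card (List.Nodup.of_map Prod.fst (hp ▸ List.nodup_ofFn.2 π.injective))] at hb
    exact hb
  · intro a b hab
    have ha : (a : ℕ) < L.length := hlen.symm ▸ a.2
    have hb' : (b : ℕ) < L.length := hlen.symm ▸ b.2
    have hpw := List.pairwise_iff_getElem.1 ((pairwise_liftRanking t π u).sublist hq)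
      a b ha hb' hab
    have ea : L[(a : ℕ)].1 = π a := hfst a ha
    have eb : L[(b : ℕ)].1 = π b := hfst b hb'
    rw [← ea, ← eb, hscore _ (List.getElem_mem _), hscore _ (List.getElem_mem _)]
    rcases hpw with h | ⟨-, h⟩
    · exact h
    -- Tied copies are listed against `π`, so a tie cannot occur between two entries that follow
    -- `π`; the order is strict.
    · rw [ea, eb, Equiv.symm_apply_apply, Equiv.symm_apply_apply] at h
      exact absurd hab (not_lt.2 h)

/-! ### The main loop -/

/-- The loop invariant, by induction on the vectors processed so far: the stored length is maximal,
and it belongs to the stored pair unless nothing was kept. -/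
theorem foldl_round_spec {n d g : ℕ} (t : Fin n → Fin d → ℝ) (π : Equiv.Perm (Fin n)) (k : ℕ)
    (us : List (Fin (d + g) → ℝ)) :
    (∀ u ∈ us, (multipleGroupLCS π (liftRanking t π u) k).length ≤
        (us.foldl (round t π k) (0, none)).1) ∧
      (us.foldl (round t π k) (0, none) = (0, none) ∨
        ∃ u ∈ us, us.foldl (round t π k) (0, none) =
          ((multipleGroupLCS π (liftRanking t π u) k).length,
            some (u, multipleGroupLCS π (liftRanking t π u) k))) := by
  induction us using List.reverseRecOn with
  | nil => simp
  | append_singleton us v ih =>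
    rw [List.foldl_append, List.foldl_cons, List.foldl_nil]
    generalize us.foldl (round t π k) (0, none) = s at *
    obtain ⟨h₁, h₂⟩ := ih
    by_cases h : s.1 < (multipleGroupLCS π (liftRanking t π v) k).length
    · rw [round, if_pos h]
      refine ⟨fun u hu => ?_, Or.inr ⟨v, by simp, rfl⟩⟩
      rcases List.mem_append.1 hu with hu | hu
      · exact (h₁ u hu).trans h.le
      · rw [List.mem_singleton.1 hu]
    · rw [round, if_neg h]
      refine ⟨fun u hu => ?_, h₂.imp_right fun ⟨u, hu, e⟩ => ⟨u, by simp [hu], e⟩⟩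
      rcases List.mem_append.1 hu with hu | hu
      · exact h₁ u hu
      · rw [List.mem_singleton.1 hu]
        exact not_lt.1 h

theorem run_eq_some_isSolution {n d g k : ℕ} (hn : 0 < n) {t : Fin n → Fin d → ℝ}
    {π : Equiv.Perm (Fin n)} {S : Scheme n d g} (hS : S.IsSolution t π k)
    {us : List (Fin (d + g) → ℝ)} (hus : IsEnumeration t us) :
    ∃ S' : Scheme n d g, run t π k us = some S' ∧ S'.IsSolution t π k ∧ ∀ i, 0 < S'.bonus i := by
  obtain ⟨v, hv, hnv⟩ := hS.exists_mem_enumeration hn hus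
  obtain ⟨hmax, h | ⟨u, hu, h⟩⟩ := foldl_round_spec t π k us
  -- A null result would have length `0`, below `n`.
  · have := hnv.trans (hmax v hv)
    rw [h] at this
    exact absurd hn (not_lt.2 this)
  · have hlen := hnv.trans (hmax v hv)
    rw [h] at hlen
    obtain ⟨h₁, h₂, h₃⟩ := multipleGroupLCS_sound π (liftRanking t π u) k
    refine ⟨readOff u (multipleGroupLCS π (liftRanking t π u) k), by rw [run, h]; rfl,
      isSolution_readOff (hus.bonus_pos hu) (h₁.eq_of_length_le ?_) h₂ h₃,
      fun i => hus.bonus_pos hu i⟩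
    simpa using hlen

end MGRA

theorem theoremD2 (n d g k : ℕ) (hn : 0 < n) (t : Fin n → Fin d → ℝ) (π : Equiv.Perm (Fin n))
    (h : ∃ S : MGRA.Scheme n d g, S.IsSolution t π k) :
    (∃ out : Option (MGRA.Scheme n d g), MGRA.Returns t π k out) ∧
      ∀ out : Option (MGRA.Scheme n d g), MGRA.Returns t π k out →
        ∃ S : MGRA.Scheme n d g, out = some S ∧ S.IsSolution t π k ∧ ∀ i, 0 < S.bonus i := by
  obtain ⟨S, hS⟩ := h
  obtain ⟨us, hus⟩ := MGRA.exists_isEnumeration (g := g) t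
  refine ⟨⟨_, us, hus, rfl⟩, ?_⟩
  rintro _ ⟨us', hus', rfl⟩
  exact MGRA.run_eq_some_isSolution hn hS hus'
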